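/- Let $F=\mathbb{R}$ or $F=\mathbb{C}$ and let $d\ge 0$ be an integer. Let $J=\begin{bmatrix}0&I_d\\-I_d&0\end{bmatrix}$ and let $\mathcal{SP}=\{H\in F^{2d\times 2d} : H^{T}JH=J\}$ be the group of symplectic matrices. Let $$\mathcal{T}=\left\{\begin{bmatrix}I&S\\0&I\end{bmatrix}\ \text{or}\ \begin{bmatrix}I&0\\S&I\end{bmatrix}\ :\ S\in F^{d\times d},\ S^{T}=S\right\}$$ be the set of unit triangular symplectic matrices, and for $n\ge 1$ let $\mathcal{L}_n=\{H_n\cdots H_2H_1 : H_i\in\mathcal{T},\ i=1,\dots,n\}$. Then $\mathcal{L}_4\subseteq\mathcal{L}_5=\mathcal{SP}$, and $\mathcal{L}_4$ is dense in $\mathcal{L}_5$, where $\mathcal{L}_5\subseteq F^{2d\times 2d}$ carries the subspace topology of the Euclidean topology. -/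

import Mathlib

namespace SymplecticFactorization

open Matrix

/-- The set `𝒯` of unit triangular symplectic matrices `[[I, S], [0, I]]` and `[[I, 0], [S, I]]`
with `S` a symmetric `d × d` matrix over `F`. -/
def unitTriangular (d : ℕ) (F : Type*) [Field F] : Set (Matrix (Fin d ⊕ Fin d) (Fin d ⊕ Fin d) F) :=
  {M | ∃ S : Matrix (Fin d) (Fin d) F, S.IsSymm ∧
    (M = fromBlocks 1 S 0 1 ∨ M = fromBlocks 1 0 S 1)}

/-- `ℒ_n`: the set of all products of exactly `n` unit triangular symplectic matrices (the factors
are listed from left to right). -/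
def triangularProducts (d : ℕ) (F : Type*) [Field F] (n : ℕ) :
    Set (Matrix (Fin d ⊕ Fin d) (Fin d ⊕ Fin d) F) :=
  {H | ∃ M : Fin n → Matrix (Fin d ⊕ Fin d) (Fin d ⊕ Fin d) F,
    (∀ i, M i ∈ unitTriangular d F) ∧ H = (List.ofFn M).prod}

/-- Mathlib's symplectic group is `{H | Hᵀ J H = J}` with `J = [[0, I], [-I, 0]]`. -/
theorem mem_symplecticGroup_iff (d : ℕ) (F : Type*) [Field F]
    (H : Matrix (Fin d ⊕ Fin d) (Fin d ⊕ Fin d) F) :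
    H ∈ symplecticGroup (Fin d) F ↔
      Hᵀ * fromBlocks 0 1 (-1) 0 * H = fromBlocks 0 1 (-1) 0 := by
  have hJ : (fromBlocks 0 1 (-1) 0 : Matrix (Fin d ⊕ Fin d) (Fin d ⊕ Fin d) F)
      = -J (Fin d) F := by
    simp [J, fromBlocks_neg]
  rw [SymplecticGroup.mem_iff', hJ]
  simp

end SymplecticFactorization

namespace SymplecticFactorization
open Matrix Polynomial

/-! Let `H` have blocks `A B C D`. If `A` is invertible, four factors suffice: write `A - 1 = Q * R`
with `Q`, `R` symmetric; the upper factor of `Q` times the lower factor of `R` has corner `A`, and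
one outer shear on each side corrects `B` and `C` (`fromBlocks_mem_triangularProducts_four`). The
splitting `Q * R` exists because every matrix is self-adjoint for some nondegenerate symmetric form.
In general some symmetric `S` makes `A + S * C` invertible, so one more shear gives five factors.
Replacing `S` by `t • S`, invertibility fails for only finitely many `t`, and `t → 0` gives density.
-/

theorem exists_nondegenerate_functional_adjoinRoot {K : Type*} [Field K] {g : K[X]}
    (hg : g.Monic) :
    ∃ l : AdjoinRoot g →ₗ[K] K, ∀ x, (∀ y, l (x * y) = 0) → x = 0 := by
  refine ⟨lcoeff K (g.natDegree - 1) ∘ₗ AdjoinRoot.modByMonicHom hg, fun x hx => ?_⟩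
  by_contra hne
  obtain ⟨p, rfl⟩ := AdjoinRoot.mk_surjective x
  set r := p %ₘ g with hr
  have hpr : AdjoinRoot.mk g p = AdjoinRoot.mk g r :=
    (AdjoinRoot.mk_leftInverse hg (AdjoinRoot.mk g p)).symm
  have hr0 : r ≠ 0 := by
    rintro h
    exact hne (by rw [hpr, h, map_zero])
  have hg1 : g ≠ 1 := by
    rintro rfl
    exact hr0 (by simp [hr])
  have hlt : r.natDegree < g.natDegree := natDegree_modByMonic_lt p hg hg1
  -- This power of `X` moves the leading coefficient of `r` into degree `g.natDegree - 1`, the one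
  -- the functional reads, with no further reduction modulo `g`.
  have h := hx (AdjoinRoot.mk g (X ^ (g.natDegree - 1 - r.natDegree)))
  rw [hpr, ← map_mul] at h
  have hdeg : (r * X ^ (g.natDegree - 1 - r.natDegree)).degree < g.degree := by
    rw [degree_mul, degree_X_pow, degree_eq_natDegree hr0, degree_eq_natDegree hg.ne_zero]
    norm_cast
    omega
  simp only [LinearMap.comp_apply, AdjoinRoot.modByMonicHom_mk, lcoeff_apply,
    (modByMonic_eq_self_iff hg).2 hdeg] at h
  have he : g.natDegree - 1 = r.natDegree + (g.natDegree - 1 - r.natDegree) := by omega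
  rw [he, Nat.add_sub_cancel_left, coeff_mul_X_pow] at h
  exact hr0 (leadingCoeff_eq_zero.1 h)

theorem exists_nondegenerate_functional_quotient_span {K : Type*} [Field K] {g : K[X]}
    (hg : g ≠ 0) :
    ∃ l : (K[X] ⧸ Ideal.span {g}) →ₗ[K] K, ∀ x, (∀ y, l (x * y) = 0) → x = 0 := by
  have hm : (g * C g.leadingCoeff⁻¹).Monic := monic_mul_leadingCoeff_inv hg
  have hI : Ideal.span {g} = Ideal.span {g * C g.leadingCoeff⁻¹} := by
    symm
    apply Ideal.span_singleton_mul_right_unit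
    simpa using hg
  rw [hI]
  exact exists_nondegenerate_functional_adjoinRoot hm

open scoped DirectSum in
theorem exists_nondegenerate_selfAdjoint_form_directSum {K : Type*} [Field K] {ι : Type*}
    [Fintype ι] (q : ι → K[X]) (hq : ∀ i, q i ≠ 0) :
    ∃ B : LinearMap.BilinForm K (⨁ i, K[X] ⧸ Ideal.span {q i}),
      (∀ x y, B x y = B y x) ∧ (∀ (f : K[X]) x y, B (f • x) y = B x (f • y)) ∧
        ∀ x, (∀ y, B x y = 0) → x = 0 := by
  classical
  choose l hl using fun i => exists_nondegenerate_functional_quotient_span (hq i)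
  have hsmul : ∀ (a : K) (x : ⨁ i, K[X] ⧸ Ideal.span {q i}) i, (a • x) i = a • x i :=
    fun a x i => rfl
  have hsmul' : ∀ (f : K[X]) (x : ⨁ i, K[X] ⧸ Ideal.span {q i}) i, (f • x) i = f • x i :=
    fun f x i => rfl
  -- Symmetry and self-adjointness both come from commutativity of the quotient rings.
  let B : LinearMap.BilinForm K (⨁ i, K[X] ⧸ Ideal.span {q i}) :=
    LinearMap.mk₂ K (fun x y => ∑ i, l i (x i * y i))
      (fun x y z => by simp [add_mul, Finset.sum_add_distrib])
      (fun a x y => by simp [hsmul, smul_mul_assoc, Finset.mul_sum])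
      (fun x y z => by simp [mul_add, Finset.sum_add_distrib])
      (fun a x y => by simp [hsmul, mul_smul_comm, Finset.mul_sum])
  refine ⟨B, fun x y => ?_, fun f x y => ?_, fun x hx => ?_⟩
  · simp [B, mul_comm]
  · simp [B, hsmul', smul_mul_assoc, mul_smul_comm]
  · ext i
    refine hl i _ fun y => ?_
    have := hx (DirectSum.of _ i y)
    simp only [B, LinearMap.mk₂_apply] at this
    rw [Finset.sum_eq_single i] at this
    · simpa using this
    · intro j _ hj
      rw [DirectSum.of_eq_of_ne _ _ _ hj, mul_zero, map_zero]
    · simp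

/-- Every endomorphism of a finite-dimensional space is self-adjoint for some nondegenerate
symmetric bilinear form. -/
theorem exists_nondegenerate_selfAdjoint_form {K V : Type*} [Field K] [AddCommGroup V]
    [Module K V] [FiniteDimensional K V] (T : Module.End K V) :
    ∃ B : LinearMap.BilinForm K V, (∀ x y, B x y = B y x) ∧
      (∀ x y, B (T x) y = B x (T y)) ∧ ∀ x, (∀ y, B x y = 0) → x = 0 := by
  -- View `V` as a torsion `K[X]`-module on which `X` acts as `T`.
  obtain ⟨ι, _, p, hp, e, ⟨φ⟩⟩ :=
    Module.equiv_directSum_of_isTorsion (Module.AEval.isTorsion_of_finiteDimensional K V T)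
  obtain ⟨B, hs, hX, hn⟩ := exists_nondegenerate_selfAdjoint_form_directSum
    (fun i => p i ^ e i) (fun i => pow_ne_zero _ (hp i).ne_zero)
  let ψ := Module.AEval.of K V T ≪≫ₗ φ.restrictScalars K
  have hψ : ∀ v, ψ (T v) = (X : K[X]) • ψ v := fun v => by
    change φ (Module.AEval.of K V T (T • v)) = (X : K[X]) • φ (Module.AEval.of K V T v)
    rw [← Module.AEval.X_smul_of, map_smul]
  refine ⟨B.compl₁₂ ψ.toLinearMap ψ.toLinearMap, fun x y => hs _ _, fun x y => ?_,
    fun x hx => ?_⟩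
  · simp [hψ, hX]
  · have : ψ x = 0 := hn _ fun y => by simpa using hx (ψ.symm y)
    simpa using this

/-- Every square matrix over a field is a product of two symmetric matrices. -/
theorem exists_isSymm_mul_isSymm {K n : Type*} [Field K] [Fintype n] [DecidableEq n]
    (A : Matrix n n K) : ∃ Q R : Matrix n n K, Q.IsSymm ∧ R.IsSymm ∧ A = Q * R := by
  obtain ⟨B, hs, hT, hn⟩ := exists_nondegenerate_selfAdjoint_form (Matrix.toLin' A)
  set M := LinearMap.BilinForm.toMatrix' B with hM
  have hB : ∀ x y, B x y = x ⬝ᵥ M *ᵥ y := fun x y => by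
    rw [← Matrix.toBilin'_apply', hM, Matrix.toBilin'_toMatrix']
  have hMs : Mᵀ = M := by
    ext i j
    simp [hM, LinearMap.BilinForm.toMatrix'_apply, hs (Pi.single j 1)]
  have hdet : M.det ≠ 0 := fun h => by
    obtain ⟨v, hv, hv0⟩ := Matrix.exists_mulVec_eq_zero_iff.2 h
    exact hv (hn v fun y => by rw [hs, hB, hv0, dotProduct_zero])
  have hAM : Aᵀ * M = M * A := by
    ext i j
    have := hT (Pi.single i 1) (Pi.single j 1)
    simp only [hB, toLin'_apply, mulVec_mulVec] at this
    rw [← vecMul_transpose, ← dotProduct_mulVec, mulVec_mulVec] at this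
    simpa using this
  have hMi : M⁻¹ * M = 1 := nonsing_inv_mul _ hdet.isUnit
  -- `M` is the Gram matrix of the form; self-adjointness of `A` says exactly that `M * A` is
  -- symmetric.
  refine ⟨M⁻¹, M * A, ?_, ?_, ?_⟩
  · rw [IsSymm, transpose_nonsing_inv, hMs]
  · rw [IsSymm, transpose_mul, hMs, hAM]
  · rw [← Matrix.mul_assoc, hMi, Matrix.one_mul]

/-- A full-rank pair `(A, C)` with `Aᵀ C` symmetric can be sheared to a pair with `A` invertible. -/
theorem exists_isSymm_det_add_mul_ne_zero {K n : Type*} [Field K] [Fintype n] [DecidableEq n]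
    (A C : Matrix n n K) (hAC : (Aᵀ * C).IsSymm)
    (hker : ∀ v, A *ᵥ v = 0 → C *ᵥ v = 0 → v = 0) :
    ∃ S : Matrix n n K, S.IsSymm ∧ (A + S * C).det ≠ 0 := by
  induction hk : Module.finrank K (LinearMap.ker (toLin' A)) using Nat.strong_induction_on
    generalizing A with
  | _ k ih =>
  by_cases hA : A.det = 0
  swap
  · exact ⟨0, isSymm_zero, by simpa using hA⟩
  obtain ⟨v, hv, hAv⟩ := Matrix.exists_mulVec_eq_zero_iff.2 hA
  have hsymm : Cᵀ * A = Aᵀ * C := by simpa [IsSymm, transpose_mul] using hAC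
  obtain ⟨i, hi⟩ := Function.ne_iff.1 fun h => hv (hker v hAv h)
  let E : Matrix n n K := Matrix.single i i 1
  have hE : E.IsSymm := by simp [E, IsSymm]
  have hECv : ∀ x, (E * C) *ᵥ x = Pi.single i ((C *ᵥ x) i) := fun x => by
    rw [← mulVec_mulVec, single_mulVec, one_mul]; rfl
  have hker_le : ∀ x, (A + E * C) *ᵥ x = 0 → (C *ᵥ x) i = 0 ∧ A *ᵥ x = 0 := by
    intro x hx
    rw [add_mulVec, hECv] at hx
    -- Symmetry of `Aᵀ * C` moves `A` onto `v`, which it kills. Pairing `hx` with `C *ᵥ v` then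
    -- isolates the `i`-th coordinate, so the kernel shrinks and loses `v`.
    have h1 : (C *ᵥ v) ⬝ᵥ (A *ᵥ x) = 0 := by
      rw [← vecMul_transpose, ← dotProduct_mulVec, mulVec_mulVec, hsymm, ← mulVec_mulVec,
        dotProduct_mulVec, vecMul_transpose, hAv, zero_dotProduct]
    have h2 := congrArg (fun z => (C *ᵥ v) ⬝ᵥ z) hx
    simp only [dotProduct_add, h1, zero_add, dotProduct_single, dotProduct_zero] at h2
    have h3 : (C *ᵥ x) i = 0 := (mul_eq_zero.1 h2).resolve_left hi
    exact ⟨h3, by simpa [h3] using hx⟩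
  have hlt : LinearMap.ker (toLin' (A + E * C)) < LinearMap.ker (toLin' A) := by
    refine lt_of_le_of_ne (fun x hx => ?_) fun h => ?_
    · simpa using (hker_le x hx).2
    · have : v ∈ LinearMap.ker (toLin' (A + E * C)) := by rw [h]; simpa using hAv
      exact hi (hker_le v this).1
  obtain ⟨S, hS, hdet⟩ := ih _ (hk ▸ Submodule.finrank_lt_finrank_of_lt hlt) (A + E * C)
    (by
      rw [IsSymm]
      simp only [transpose_add, transpose_mul, Matrix.add_mul, transpose_transpose, hE.eq,
        hsymm, Matrix.mul_assoc])
    (fun x hx hCx => hker x (hker_le x hx).2 hCx) rfl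
  exact ⟨S + E, hS.add hE, by rwa [Matrix.add_mul, add_comm (S * C), ← add_assoc]⟩

theorem finite_setOf_det_add_smul_eq_zero {K n : Type*} [Field K] [Fintype n] [DecidableEq n]
    (A M : Matrix n n K) (h : (A + M).det ≠ 0) : {t : K | (A + t • M).det = 0}.Finite := by
  set P : K[X] := det ((X : K[X]) • M.map C + A.map C) with hP
  have heval : ∀ t, P.eval t = (A + t • M).det := fun t => by
    rw [hP, ← coe_evalRingHom, RingHom.map_det]
    congr 1
    ext i j
    simp only [Matrix.map_apply, coe_evalRingHom, RingHom.mapMatrix_apply, Matrix.add_apply,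
      Matrix.smul_apply, smul_eq_mul, eval_add, eval_mul, eval_X, eval_C]
    ring
  have hP0 : P ≠ 0 := fun h0 => h (by rw [← one_smul K M, ← heval, h0, eval_zero])
  refine (P.rootSet_finite K).subset fun t ht => ?_
  rw [mem_rootSet]
  exact ⟨hP0, by simpa [heval] using ht⟩

section Products

variable {d : ℕ} {K : Type*} [Field K]

theorem upper_mem_unitTriangular {S : Matrix (Fin d) (Fin d) K} (hS : S.IsSymm) :
    fromBlocks 1 S 0 1 ∈ unitTriangular d K := ⟨S, hS, Or.inl rfl⟩

theorem lower_mem_unitTriangular {S : Matrix (Fin d) (Fin d) K} (hS : S.IsSymm) :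
    fromBlocks 1 0 S 1 ∈ unitTriangular d K := ⟨S, hS, Or.inr rfl⟩

theorem one_mem_unitTriangular : (1 : Matrix (Fin d ⊕ Fin d) (Fin d ⊕ Fin d) K) ∈
    unitTriangular d K := ⟨0, isSymm_zero, Or.inl fromBlocks_one.symm⟩

theorem unitTriangular_subset_symplecticGroup :
    unitTriangular d K ⊆ (symplecticGroup (Fin d) K : Set _) := by
  rintro _ ⟨S, hS, rfl | rfl⟩ <;>
    simp [SymplecticGroup.fromBlocks_mem_iff, hS.eq]

theorem triangularProducts_subset_symplecticGroup (n : ℕ) :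
    triangularProducts d K n ⊆ (symplecticGroup (Fin d) K : Set _) := by
  rintro _ ⟨M, hM, rfl⟩
  refine Submonoid.list_prod_mem _ fun x hx => ?_
  obtain ⟨i, rfl⟩ := (List.mem_ofFn' M x).1 hx
  exact unitTriangular_subset_symplecticGroup (hM i)

theorem mul_mem_triangularProducts_succ {n : ℕ} {M H : Matrix (Fin d ⊕ Fin d) (Fin d ⊕ Fin d) K}
    (hM : M ∈ unitTriangular d K) (hH : H ∈ triangularProducts d K n) :
    M * H ∈ triangularProducts d K (n + 1) := by
  obtain ⟨N, hN, rfl⟩ := hH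
  refine ⟨Fin.cons M N, Fin.cases (by simpa using hM) (by simpa using hN), ?_⟩
  simp [List.ofFn_succ]

theorem triangularProducts_subset_succ (n : ℕ) :
    triangularProducts d K n ⊆ triangularProducts d K (n + 1) := fun H hH => by
  simpa using mul_mem_triangularProducts_succ one_mem_unitTriangular hH

/-- A symplectic matrix with invertible upper left block is a product of four unit triangular
symplectic matrices. -/
theorem fromBlocks_mem_triangularProducts_four {A B C D : Matrix (Fin d) (Fin d) K}
    (h : fromBlocks A B C D ∈ symplecticGroup (Fin d) K) (hA : A.det ≠ 0) :
    fromBlocks A B C D ∈ triangularProducts d K 4 := by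
  obtain ⟨hAC, -, hADCB⟩ := SymplecticGroup.fromBlocks_mem_iff.1 h
  have hAB : A * Bᵀ = B * Aᵀ := by
    have := SymplecticGroup.transpose_mem h
    rw [fromBlocks_transpose, SymplecticGroup.fromBlocks_mem_iff] at this
    simpa using this.1
  obtain ⟨Q, R, hQ, hR, hQR⟩ := exists_isSymm_mul_isSymm (A - 1)
  have hA' : A = 1 + Q * R := by rw [← hQR]; abel
  have hAT : Aᵀ = 1 + R * Q := by rw [hA', transpose_add, transpose_mul, hQ.eq, hR.eq]; simp
  have hl : A⁻¹ * A = 1 := nonsing_inv_mul _ hA.isUnit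
  have hr : A * A⁻¹ = 1 := mul_nonsing_inv _ hA.isUnit
  have htr : Aᵀ * A⁻¹ᵀ = 1 := by rw [← transpose_mul, hl, transpose_one]
  have htl : A⁻¹ᵀ * Aᵀ = 1 := by rw [← transpose_mul, hr, transpose_one]
  -- `P` and `T` are forced by the lower left and upper right blocks of the product `N` below.
  set P := (C - R) * A⁻¹ with hPdef
  set T := A⁻¹ * (B - Q) with hTdef
  have hPA : P * A = C - R := by rw [hPdef, Matrix.mul_assoc, hl, Matrix.mul_one]
  have hAT' : A * T = B - Q := by rw [hTdef, ← Matrix.mul_assoc, hr, Matrix.one_mul]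
  have hP : P.IsSymm := by
    have key : Aᵀ * (C - R) = (C - R)ᵀ * A := by
      rw [transpose_sub, hR.eq, Matrix.mul_sub, Matrix.sub_mul, hAC, hAT]
      simp only [hA', Matrix.mul_add, Matrix.add_mul, Matrix.mul_assoc, Matrix.mul_one,
        Matrix.one_mul]
    calc Pᵀ = A⁻¹ᵀ * ((C - R)ᵀ * A) * A⁻¹ := by
          rw [hPdef, transpose_mul, ← Matrix.mul_assoc, Matrix.mul_assoc _ A, hr, Matrix.mul_one]
      _ = P := by rw [← key, ← Matrix.mul_assoc, htl, Matrix.one_mul]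
  have hT : T.IsSymm := by
    have key : (B - Q) * Aᵀ = A * (B - Q)ᵀ := by
      rw [transpose_sub, hQ.eq, Matrix.mul_sub, Matrix.sub_mul, hAB, hAT]
      simp only [hA', Matrix.mul_add, Matrix.add_mul, Matrix.mul_assoc, Matrix.mul_one,
        Matrix.one_mul]
    calc Tᵀ = A⁻¹ * (A * (B - Q)ᵀ) * A⁻¹ᵀ := by
          rw [hTdef, transpose_mul, ← Matrix.mul_assoc A⁻¹ A, hl, Matrix.one_mul]
      _ = T := by rw [← key, Matrix.mul_assoc, Matrix.mul_assoc, htr, Matrix.mul_one]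
  set N : Matrix (Fin d ⊕ Fin d) (Fin d ⊕ Fin d) K :=
    fromBlocks 1 0 P 1 * (fromBlocks 1 Q 0 1 * (fromBlocks 1 0 R 1 * (fromBlocks 1 T 0 1 * 1)))
    with hN
  have hNmem : N ∈ triangularProducts d K 4 :=
    mul_mem_triangularProducts_succ (lower_mem_unitTriangular hP) <|
    mul_mem_triangularProducts_succ (upper_mem_unitTriangular hQ) <|
    mul_mem_triangularProducts_succ (lower_mem_unitTriangular hR) <|
    mul_mem_triangularProducts_succ (upper_mem_unitTriangular hT)
      ⟨Fin.elim0, fun i => i.elim0, by simp⟩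
  have hNeq : N = fromBlocks A B C (P * B + (R * T + 1)) := by
    have hB : Q + A * T = B := by rw [hAT']; abel
    have hC : P * A + R = C := by rw [hPA]; abel
    simp only [hN, Matrix.mul_one, fromBlocks_multiply, Matrix.one_mul, Matrix.zero_mul,
      add_zero, zero_add, Matrix.mul_zero]
    congr 1
    · exact hA'.symm
    · rw [← hB, hA']; noncomm_ring
    · rw [← hC, hA']
    · rw [← hB, hA']; noncomm_ring
  -- For invertible `A`, the relation `Aᵀ * D - Cᵀ * B = 1` determines `D` from the other blocks.
  have hD : D = P * B + (R * T + 1) := by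
    have hNs := triangularProducts_subset_symplecticGroup 4 hNmem
    rw [hNeq, SetLike.mem_coe, SymplecticGroup.fromBlocks_mem_iff] at hNs
    have : Aᵀ * D = Aᵀ * (P * B + (R * T + 1)) := by
      rw [← sub_left_inj (a := Cᵀ * B), hADCB, hNs.2.2]
    simpa [← Matrix.mul_assoc, htl] using congrArg (A⁻¹ᵀ * ·) this
  rw [hD, ← hNeq]
  exact hNmem

theorem upper_mul_mem_triangularProducts_four {A B C D S : Matrix (Fin d) (Fin d) K}
    (h : fromBlocks A B C D ∈ symplecticGroup (Fin d) K) (hS : S.IsSymm)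
    (hdet : (A + S * C).det ≠ 0) :
    fromBlocks 1 S 0 1 * fromBlocks A B C D ∈ triangularProducts d K 4 := by
  have hmem := mul_mem (unitTriangular_subset_symplecticGroup (upper_mem_unitTriangular hS)) h
  simp only [fromBlocks_multiply, Matrix.one_mul] at hmem ⊢
  exact fromBlocks_mem_triangularProducts_four hmem hdet

theorem exists_isSymm_det_add_mul_ne_zero_of_mem_symplecticGroup
    {A B C D : Matrix (Fin d) (Fin d) K} (h : fromBlocks A B C D ∈ symplecticGroup (Fin d) K) :
    ∃ S : Matrix (Fin d) (Fin d) K, S.IsSymm ∧ (A + S * C).det ≠ 0 := by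
  obtain ⟨hAC, -, hADCB⟩ := SymplecticGroup.fromBlocks_mem_iff.1 h
  refine exists_isSymm_det_add_mul_ne_zero A C (by simp [IsSymm, transpose_mul, hAC])
    fun v hAv hCv => ?_
  have h1 : Dᵀ * A - Bᵀ * C = 1 := by
    simpa [transpose_mul] using congrArg transpose hADCB
  rw [← one_mulVec v, ← h1, sub_mulVec, ← mulVec_mulVec, ← mulVec_mulVec, hAv, hCv]
  simp

theorem triangularProducts_five_eq :
    triangularProducts d K 5 = (symplecticGroup (Fin d) K : Set _) := by
  refine (triangularProducts_subset_symplecticGroup 5).antisymm fun H hH => ?_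
  obtain ⟨A, B, C, D, rfl⟩ : ∃ A B C D, H = fromBlocks A B C D :=
    ⟨_, _, _, _, (fromBlocks_toBlocks H).symm⟩
  obtain ⟨S, hS, hdet⟩ := exists_isSymm_det_add_mul_ne_zero_of_mem_symplecticGroup hH
  have := mul_mem_triangularProducts_succ (upper_mem_unitTriangular hS.neg)
    (upper_mul_mem_triangularProducts_four hH hS hdet)
  rw [← Matrix.mul_assoc, fromBlocks_multiply] at this
  simpa using this

end Products

end SymplecticFactorization

theorem mainTheorem4 {F : Type*} [RCLike F] (d : ℕ) :
    SymplecticFactorization.triangularProducts d F 5 =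
        (Matrix.symplecticGroup (Fin d) F :
          Set (Matrix (Fin d ⊕ Fin d) (Fin d ⊕ Fin d) F)) ∧
      SymplecticFactorization.triangularProducts d F 4 ⊆
        SymplecticFactorization.triangularProducts d F 5 ∧
      Dense {H : SymplecticFactorization.triangularProducts d F 5 |
        (H : Matrix (Fin d ⊕ Fin d) (Fin d ⊕ Fin d) F) ∈
          SymplecticFactorization.triangularProducts d F 4} := by
  open Matrix SymplecticFactorization in
  refine ⟨triangularProducts_five_eq, triangularProducts_subset_succ 4, ?_⟩
  rintro ⟨H, hH⟩
  have hHs := hH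
  rw [triangularProducts_five_eq] at hHs
  obtain ⟨A, B, C, D, rfl⟩ : ∃ A B C D, H = fromBlocks A B C D :=
    ⟨_, _, _, _, (fromBlocks_toBlocks H).symm⟩
  obtain ⟨S, hS, hdet⟩ := exists_isSymm_det_add_mul_ne_zero_of_mem_symplecticGroup hHs
  have hfin := finite_setOf_det_add_smul_eq_zero A (S * C) hdet
  let γ : F → triangularProducts d F 5 := fun t =>
    ⟨fromBlocks 1 (t • S) 0 1 * fromBlocks A B C D, by
      rw [triangularProducts_five_eq]
      exact mul_mem (unitTriangular_subset_symplecticGroup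
        (upper_mem_unitTriangular (hS.smul t))) hHs⟩
  have hγ : Continuous γ := by
    refine Continuous.subtype_mk (Continuous.matrix_mul ?_ continuous_const) _
    exact Continuous.matrix_fromBlocks continuous_const (continuous_id.smul continuous_const)
      continuous_const continuous_const
  have hγ0 : γ 0 = ⟨fromBlocks A B C D, hH⟩ := Subtype.ext (by simp [γ])
  rw [← hγ0]
  -- The value `0` may itself be exceptional, but it remains a limit of good parameters.
  refine map_mem_closure hγ (dense_univ.sdiff_finite hfin 0) fun t ht => ?_
  refine upper_mul_mem_triangularProducts_four hHs (hS.smul t) ?_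
  rw [Matrix.smul_mul]
  exact ht.2
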